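/- Let $\mathbf e_1,\mathbf e_2,\mathbf e_3$ be vectors of a plane with $\mathbf e_1+\mathbf e_2+\mathbf e_3=\mathbf 0$ and $\mathbf e_1,\mathbf e_2$ linearly independent. Indices $i=1,2,3$ are understood modulo $3$. The honeycomb lattice is $\Lambda=\Lambda^{+}\cup\Lambda^{-}$, where $\Lambda^{+}$ (resp. $\Lambda^{-}$) is the set of vectors $\mathbf n=\sum_{i}n_i\mathbf e_i$, $n_i\in\mathbb Z$, with $\sum_i n_i\equiv 0$ (resp. $\equiv 1$) modulo $3$; write $\Lambda^{\pm1}=\Lambda^{\pm}$. For constants $\Gamma_1,\Gamma_2,\Gamma_3$ with $\Gamma_1+\Gamma_2+\Gamma_3=0$, the honeycomb equations for a function $u$ on $\Lambda$ are $$\sum_{i=1}^{3}\frac{\Gamma_i}{u(\mathbf n)-u(\mathbf n+\mathbf e_i)}=0\quad(\mathbf n\in\Lambda^{+}),\qquad \sum_{i=1}^{3}\frac{\Gamma_i}{u(\mathbf n)-u(\mathbf n-\mathbf e_i)}=0\quad(\mathbf n\in\Lambda^{-}).$$ Let $\ell\ge 1$ be an integer, $\alpha_1,\alpha_2,\alpha_3\in\mathbb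 C$, $\gamma$ a (piecewise $C^1$, possibly infinite) contour in $\mathbb C$ and $\hat\omega$ a complex function. Put $\mathcal N(n_1,n_2,n_3)=\lfloor (n_1+n_2+n_3+2)/3\rfloor$ and, for $\mathbf n=\sum_i n_i\mathbf e_i$, $$\omega_m(\mathbf n)=\int_\gamma \hat\omega(h)\,h^m\prod_{i=1}^{3}(h-\alpha_i)^{\,n_i-\mathcal N(n_1,n_2,n_3)}\,dh,\qquad D_k(\mathbf n)=\det\bigl[\omega_{k-a+b}(\mathbf n)\bigr]_{a,b=1}^{\ell+k}\quad(k=0,\pm1),$$ the determinant of size $0$ being $1$. Assume that the integrals that are entries of $D_0(\mathbf n)$ and $D_{-\epsilon}(\mathbf n)$, for $\mathbf n\in\Lambda^{\epsilon}$, $\epsilon=\pm1$, converge absolutely. Let $\Gamma_i=\alpha_{i+1}-\alpha_{i-1}$ (so that $\Gamma_1+\Gamma_2+\Gamma_3=0$). Then $$u(\mathbf n)=\epsilon\left[\frac{D_{-\epsilon}(\mathbf n)}{D_0(\mathbf n)}\right]^{\epsilon}\qquad(\mathbf n\in\Lambda^{\epsilon},\ \epsilon=\pm1),$$ that is, $u=D_{-1}/D_0$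 on $\Lambda^{+}$ and $u=-D_0/D_1$ on $\Lambda^{-}$, does not depend on the choice of the integers $n_i$ representing $\mathbf n$, and it solves the honeycomb equations: the equation at a vertex $\mathbf n$ holds whenever its terms are defined, i.e. whenever the denominators of $u$ at $\mathbf n$ and at its three neighbours ($D_0$ on $\Lambda^{+}$, $D_1$ on $\Lambda^{-}$) are nonzero and $u(\mathbf n)$ differs from the value of $u$ at each of the three neighbours. -/

import Mathlib

namespace Honeycomb

open MeasureTheory

/-- A contour in `ℂ`: a continuous, piecewise continuously differentiable map on a real interval,
which may be open, closed or unbounded. Closed loops and infinite contours are included. -/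
structure Contour where
  /-- the parameter interval -/
  dom : Set ℝ
  /-- the parametrization; only its values on `dom` matter -/
  path : ℝ → ℂ
  ordConnected : dom.OrdConnected
  continuousOn : ContinuousOn path dom
  piecewise_C1 : ∃ corners : Set ℝ, (∀ a b : ℝ, (corners ∩ Set.Icc a b).Finite) ∧
    ∀ t ∈ interior dom \ corners, ContDiffAt ℝ 1 path t

/-- The contour integral `∫_γ f(h) dh` converges absolutely. -/
def Contour.Integrable (γ : Contour) (f : ℂ → ℂ) : Prop :=
  IntegrableOn (fun t : ℝ => f (γ.path t) * deriv γ.path t) γ.dom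

/-- The contour integral `∫_γ f(h) dh`. -/
noncomputable def Contour.integral (γ : Contour) (f : ℂ → ℂ) : ℂ :=
  ∫ t in γ.dom, f (γ.path t) * deriv γ.path t

/-- The vector `n₁ e₁ + n₂ e₂ + n₃ e₃`. Indices are taken in `Fin 3`, where arithmetic is modulo
`3`. -/
def node {E : Type*} [AddCommGroup E] (e : Fin 3 → E) (n : Fin 3 → ℤ) : E :=
  ∑ i, n i • e i

/-- The integer triple `n` represents a vector of `Λ⁺` (for `ε = 1`) or of `Λ⁻` (for `ε = -1`):
its coordinate sum is `0`, respectively `1`, modulo `3`. -/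
def InLattice (ε : ℤˣ) (n : Fin 3 → ℤ) : Prop :=
  (∑ i, n i) ≡ (if ε = 1 then 0 else 1) [ZMOD 3]

/-- `𝒩(n) = ⌊(n₁ + n₂ + n₃ + 2) / 3⌋`; division of integers by `3` rounds down. -/
def shift (n : Fin 3 → ℤ) : ℤ := ((∑ i, n i) + 2) / 3

/-- The integrand `ω̂(h) h ^ m ∏ i, (h - αᵢ) ^ (nᵢ - 𝒩(n))`. -/
noncomputable def integrand (w : ℂ → ℂ) (α : Fin 3 → ℂ) (m : ℤ) (n : Fin 3 → ℤ) (h : ℂ) : ℂ :=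
  w h * h ^ m * ∏ i, (h - α i) ^ (n i - shift n)

/-- The moment `ω_m(n)`. -/
noncomputable def moment (γ : Contour) (w : ℂ → ℂ) (α : Fin 3 → ℂ) (m : ℤ) (n : Fin 3 → ℤ) : ℂ :=
  γ.integral (integrand w α m n)

/-- The Toeplitz determinant `D_k(n)`, of size `ℓ + k` (the empty determinant is `1`). -/
noncomputable def toeplitzD (γ : Contour) (w : ℂ → ℂ) (α : Fin 3 → ℂ) (ℓ : ℕ) (k : ℤ)
    (n : Fin 3 → ℤ) : ℂ :=
  (Matrix.of fun a b : Fin ((ℓ : ℤ) + k).toNat =>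
    moment γ w α (k - ((a : ℕ) : ℤ) + ((b : ℕ) : ℤ)) n).det

/-- All the moments which are entries of the determinants `D_0(n)`, `D_{-ε}(n)`, `n ∈ Λ^ε`, exist,
as absolutely convergent integrals. -/
def MomentsExist (γ : Contour) (w : ℂ → ℂ) (α : Fin 3 → ℂ) (ℓ : ℕ) : Prop :=
  ∀ (ε : ℤˣ) (n : Fin 3 → ℤ), InLattice ε n → ∀ k : ℤ, k = 0 ∨ k = -(ε : ℤ) →
    ∀ a b : Fin ((ℓ : ℤ) + k).toNat,
      γ.Integrable (integrand w α (k - ((a : ℕ) : ℤ) + ((b : ℕ) : ℤ)) n)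

end Honeycomb

/-!
All the determinants at a vertex and its three neighbours are built from one sequence of moments.
Reversing the rows turns `D_k` into a Hankel determinant `H_N`, `N = ℓ + k`, of the moments of
`h ^ (1 - ℓ), h ^ (2 - ℓ), …`, and passing from a vertex to a neighbour multiplies or divides the
weight by some of the factors `h - αᵢ`. Writing `S_α` for the effect of the factor `h - α` on
moments (`mulSub`), three identities between Hankel determinants are needed, where `i, j, k` is a
cyclic permutation of the indices:

* `H_ℓ(v) H_ℓ(SⱼSₖv) - H_{ℓ+1}(v) H_{ℓ-1}(SⱼSₖv) = H_ℓ(Sⱼv) H_ℓ(Sₖv)` (`hankel_mul_hankel_sub`);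
* `∑ i, (αⱼ - αₖ) H_ℓ(Sᵢv) H_ℓ(SⱼSₖv) = 0` (`sum_hankel_mul_hankel`);
* `∑ i, (αⱼ - αₖ) H_{ℓ+1}(Sᵢx) H_ℓ(SⱼSₖx) = 0` (`sum_hankel_succ_mul_hankel`).

All three are instances of the three-term Plücker relation (`rowDet_plucker`), which follows from
Cramer's rule, since bordering a Hankel matrix by the row `α ^ b` applies `S_α` to its sequence
(`rowDet_cons_pow`). The first one shows that the difference of `u` along the `i`-th edge is
`± Aⱼ Aₖ / (c Tᵢ)`, where `c` and `Tᵢ` are the denominators of `u` at the two ends of the edge. The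
honeycomb equation becomes `∑ i, Γᵢ Tᵢ Aᵢ = 0` (`sum_div_eq_zero`), which is the second identity
at a vertex of `Λ⁻` and the third one at a vertex of `Λ⁺`.

Two analytic points remain. The contour may pass through, or even stay at, `0` or some `αᵢ`; but
`dh` vanishes almost everywhere on such a set (`Contour.ae_deriv_eq_zero_or_ne`), so the usual rules
for powers apply under the integral. At a vertex of `Λ⁺` the common sequence `x` belongs to a weight
`X` which occurs at no vertex of the star. Its moments nevertheless converge if `αᵢ ≠ αⱼ` for some
`i, j`, because then `X` is a combination of the neighbouring weights `(h - αᵢ) X` and `(h - αⱼ) X`;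
if all `αᵢ` are equal, every `Γᵢ` is zero.
-/

namespace Honeycomb

/-! ### The Plücker relation and Hankel determinants -/

section Algebra

open Matrix

variable {R : Type*} [CommRing R]

/-- The three-term Plücker relation, for `n` fixed rows `F` and four further rows taken in pairs. -/
theorem det_cons_cons_plucker {n : ℕ} (F : Fin n → Fin (n + 2) → R) (p q r s : Fin (n + 2) → R) :
    (of (vecCons p (vecCons q F))).det * (of (vecCons r (vecCons s F))).det
      - (of (vecCons p (vecCons r F))).det * (of (vecCons q (vecCons s F))).det
      + (of (vecCons p (vecCons s F))).det * (of (vecCons q (vecCons r F))).det = 0 := by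
  set B : (Fin (n + 2) → R) → (Fin (n + 2) → R) → R :=
    fun x y => (of (vecCons x (vecCons y F))).det with hB
  have hupd0 : ∀ x y z, (of (vecCons x (vecCons y F))).updateRow 0 z =
      of (vecCons z (vecCons y F)) := by
    intro x y z
    ext i j
    refine Fin.cases ?_ (fun i => ?_) i <;> simp [updateRow_apply]
  have hupd1 : ∀ x y z, (of (vecCons x (vecCons y F))).updateRow 1 z =
      of (vecCons x (vecCons z F)) := by
    intro x y z
    ext i j
    refine Fin.cases ?_ (fun i => Fin.cases ?_ (fun i => ?_) i) i
    · simp [updateRow_apply]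
    · simp [updateRow_apply]
    · simp [updateRow_apply, Fin.ext_iff]
  have hswap : ∀ x y, B x y = - B y x := by
    intro x y
    have h := (detRowAlternating (R := R) (n := Fin (n + 2))).map_swap
      (vecCons y (vecCons x F)) (i := 0) (j := 1) (by simp)
    have e : (vecCons y (vecCons x F)) ∘ Equiv.swap (0 : Fin (n + 2)) 1
        = vecCons x (vecCons y F) := by
      funext i
      refine Fin.cases ?_ (fun i => Fin.cases ?_ (fun i => ?_) i) i
      · simp
      · simp
      · rw [Function.comp_apply, Equiv.swap_apply_of_ne_of_ne] <;> simp [Fin.ext_iff]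
    rw [e] at h
    exact h
  -- Cramer's rule writes `B p q • r` in terms of the rows `p`, `q`, `F`; it remains to apply the
  -- linear map `B · s`, which kills the rows of `F`.
  have hc := mulVec_cramer (of (vecCons p (vecCons q F)))ᵀ r
  have hsum : B p q • r = B r q • p + B p r • q
      + ∑ i : Fin n, cramer (of (vecCons p (vecCons q F)))ᵀ r i.succ.succ • F i := by
    rw [det_transpose, mulVec_transpose, vecMul_eq_sum] at hc
    rw [← hc, Fin.sum_univ_succ, Fin.sum_univ_succ, cramer_transpose_apply,
      show Fin.succ (0 : Fin (n + 1)) = 1 from rfl, cramer_transpose_apply, hupd0, hupd1,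
      ← add_assoc]
    rfl
  have hadd : ∀ x y, B (x + y) s = B x s + B y s := by
    intro x y
    have := det_updateRow_add (of (vecCons p (vecCons s F))) 0 x y
    simpa only [hupd0] using this
  have hsmul : ∀ (c : R) x, B (c • x) s = c * B x s := by
    intro c x
    have := det_updateRow_smul (of (vecCons p (vecCons s F))) 0 c x
    simpa only [hupd0] using this
  let L : (Fin (n + 2) → R) →ₗ[R] R :=
    { toFun := fun x => B x s, map_add' := hadd, map_smul' := hsmul }
  have hF : ∀ i, B (F i) s = 0 := fun i =>
    det_zero_of_row_eq (i := 0) (j := i.succ.succ) (by simp [Fin.ext_iff]) rfl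
  have key := congrArg L hsum
  simp only [map_add, map_smul, map_sum, smul_eq_mul] at key
  have hF' : ∀ i, L (F i) = 0 := hF
  simp only [hF', mul_zero, Finset.sum_const_zero, add_zero] at key
  change B p q * B r s = B r q * B p s + B p r * B q s at key
  change B p q * B r s - B p r * B q s + B p s * B q r = 0
  rw [hswap q r]
  linear_combination key

/-- If `y` is the sequence of moments of a linear functional on polynomials in `h`, then
`mulSub α y` is the sequence of moments of that functional multiplied by `h - α`. -/
def mulSub (α : R) (y : ℕ → R) (m : ℕ) : R := y (m + 1) - α * y m

theorem mulSub_comm (α β : R) (y : ℕ → R) : mulSub α (mulSub β y) = mulSub β (mulSub α y) := by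
  funext m
  simp only [mulSub]
  ring

theorem mulSub_pow (α β : R) : mulSub α (fun b => β ^ b) = (β - α) • fun b => β ^ b := by
  funext m
  simp only [mulSub, Pi.smul_apply, smul_eq_mul]
  ring

/-- The determinant whose `a`-th row consists of the first `n` terms of the sequence `F a`. A
sequence is seen as a linear functional on polynomials, by its values on the monomials; the size
`n` restricts it to degree less than `n`. -/
def rowDet {n : ℕ} (F : Fin n → ℕ → R) : R := (of fun a b : Fin n => F a b).det

/-- The Plücker relation for four functionals `p, q, r, s` and `n` fixed ones. -/
theorem rowDet_plucker {n : ℕ} (F : Fin n → ℕ → R) (p q r s : ℕ → R) :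
    rowDet (vecCons p (vecCons q F)) * rowDet (vecCons r (vecCons s F))
      - rowDet (vecCons p (vecCons r F)) * rowDet (vecCons q (vecCons s F))
      + rowDet (vecCons p (vecCons s F)) * rowDet (vecCons q (vecCons r F)) = 0 := by
  have e : ∀ x y : ℕ → R, rowDet (vecCons x (vecCons y F)) =
      (of (vecCons (fun b : Fin (n + 2) => x b) (vecCons (fun b : Fin (n + 2) => y b)
        fun i (b : Fin (n + 2)) => F i b))).det := by
    intro x y
    unfold rowDet
    congr 1
    ext i j
    refine Fin.cases ?_ (fun i => Fin.cases ?_ (fun i => ?_) i) i <;> simp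
  simp only [e]
  exact det_cons_cons_plucker _ _ _ _ _

theorem rowDet_swap {n : ℕ} (F : Fin n → ℕ → R) (p q : ℕ → R) :
    rowDet (vecCons p (vecCons q F)) = - rowDet (vecCons q (vecCons p F)) := by
  have h := (detRowAlternating (R := R) (n := Fin (n + 2))).map_swap
    (fun a b : Fin (n + 2) => vecCons q (vecCons p F) a b) (i := 0) (j := 1) (by simp)
  have e : (fun a b : Fin (n + 2) => vecCons q (vecCons p F) a (b : ℕ)) ∘
      Equiv.swap (0 : Fin (n + 2)) 1 =
        fun a (b : Fin (n + 2)) => vecCons p (vecCons q F) a (b : ℕ) := by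
    funext i
    refine Fin.cases ?_ (fun i => Fin.cases ?_ (fun i => ?_) i) i
    · simp
    · simp
    · rw [Function.comp_apply, Equiv.swap_apply_of_ne_of_ne] <;> simp [Fin.ext_iff]
  rw [e] at h
  exact h

theorem rowDet_smul_cons {n : ℕ} (c : R) (p : ℕ → R) (F : Fin n → ℕ → R) :
    rowDet (vecCons (c • p) F) = c * rowDet (vecCons p F) := by
  simp only [rowDet, det_succ_row_zero, Finset.mul_sum]
  refine Finset.sum_congr rfl fun j _ => ?_
  have : (of fun a b : Fin (n + 1) => vecCons (c • p) F a b).submatrix Fin.succ j.succAbove =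
      (of fun a b : Fin (n + 1) => vecCons p F a b).submatrix Fin.succ j.succAbove := by
    ext a b; simp
  rw [this]
  simp only [of_apply, cons_val_zero, Pi.smul_apply, smul_eq_mul]
  ring

/-- The sequence `α ^ b` is the evaluation at `α`. Bordering by it restricts the other functionals
to the polynomials which vanish at `α`, that is, multiplies them by `h - α`. -/
theorem rowDet_cons_pow {n : ℕ} (α : R) (F : Fin n → ℕ → R) :
    rowDet (vecCons (fun b => α ^ b) F) = rowDet fun a => mulSub α (F a) := by
  let N : Matrix (Fin (n + 1)) (Fin (n + 1)) R :=
    of fun a b => Fin.cases (vecCons (fun b => α ^ b) F a 0)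
      (fun b : Fin n => mulSub α (vecCons (fun b => α ^ b) F a) b) b
  have h : rowDet (vecCons (fun b => α ^ b) F) = N.det := by
    refine det_eq_of_forall_col_eq_smul_add_pred (fun _ => α) (fun a => by simp [N]) fun a b => ?_
    simp [N, mulSub]
  rw [h, det_succ_row_zero, Fin.sum_univ_succ, Finset.sum_eq_zero]
  · simp only [N, rowDet]
    simp
    rfl
  · intro b _
    simp [N, mulSub_pow]

/-- Bordering by the coefficient of `h ^ n`, the evaluation at infinity, restricts the other
functionals to polynomials of smaller degree. -/
theorem rowDet_cons_last {n : ℕ} (F : Fin n → ℕ → R) :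
    rowDet (vecCons (fun b => if b = n then 1 else 0) F) = (-1) ^ n * rowDet F := by
  rw [rowDet, det_succ_row_zero, Fin.sum_univ_castSucc, Finset.sum_eq_zero]
  · simp [rowDet, submatrix]
  · intro b _
    simp [b.2.ne]

/-- The Hankel determinant of size `n` of the sequence `y`. -/
def hankel (n : ℕ) (y : ℕ → R) : R := (of fun a b : Fin n => y (a + b)).det

/-- A Hankel determinant of size `n` only sees the terms of index at most `2 n - 2`. -/
theorem hankel_congr {n : ℕ} {y z : ℕ → R} (h : ∀ m, m + 2 ≤ 2 * n → y m = z m) :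
    hankel n y = hankel n z := by
  unfold hankel
  congr 1
  ext a b
  exact h _ (by omega)

theorem rowDet_hankel (n : ℕ) (y : ℕ → R) :
    rowDet (fun (a : Fin n) b => y (a + b)) = hankel n y := rfl

theorem mulSub_shift (α : R) (y : ℕ → R) (a : ℕ) :
    mulSub α (fun b => y (a + b)) = fun b => mulSub α y (a + b) := by
  funext b
  simp only [mulSub, add_assoc]

theorem rowDet_pow_pow {n : ℕ} (α β : R) (y : ℕ → R) :
    rowDet (vecCons (fun b => α ^ b) (vecCons (fun b => β ^ b) fun (a : Fin n) b => y (a + b))) =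
      (β - α) * hankel n (mulSub β (mulSub α y)) := by
  rw [rowDet_cons_pow]
  have : (fun a => mulSub α (vecCons (fun b => β ^ b) (fun (a : Fin n) b => y (a + b)) a)) =
      vecCons ((β - α) • fun b => β ^ b) fun (a : Fin n) b => mulSub α y (a + b) := by
    funext a
    refine Fin.cases ?_ (fun a => ?_) a
    · simp [mulSub_pow]
    · simp [mulSub_shift]
  rw [this, rowDet_smul_cons, rowDet_cons_pow]
  simp only [mulSub_shift]
  rfl

theorem rowDet_pow_hankel {n : ℕ} (α : R) (y : ℕ → R) :
    rowDet (vecCons (fun b => α ^ b) fun (a : Fin n) b => y (a + b)) = hankel n (mulSub α y) := by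
  rw [rowDet_cons_pow]
  simp only [mulSub_shift]
  rfl

/-- Multiplying all rows but the first by `h - α` is a unitriangular operation on the rows of a
Hankel matrix. -/
theorem rowDet_cons_mulSub {n : ℕ} (α : R) (y : ℕ → R) :
    rowDet (vecCons y fun (a : Fin n) b => mulSub α y (a + b)) = hankel (n + 1) y := by
  symm
  refine det_eq_of_forall_row_eq_smul_add_pred (fun _ => α) (fun b => by simp) fun a b => ?_
  simp only [of_apply, cons_val_succ, mulSub, Fin.val_succ, Fin.val_castSucc]
  rw [show (a : ℕ) + 1 + b = a + b + 1 by omega]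
  ring

theorem rowDet_cons_eq_snoc {n : ℕ} (p : ℕ → R) (F : Fin n → ℕ → R) :
    rowDet (vecCons p F) = (-1) ^ n * rowDet (Fin.snoc F p : Fin (n + 1) → ℕ → R) := by
  have h := det_permute (finRotate (n + 1)) (of fun a b : Fin (n + 1) => vecCons p F a b)
  have e : (of fun a b : Fin (n + 1) => vecCons p F a b).submatrix (finRotate (n + 1)) id =
      of fun a b : Fin (n + 1) => (Fin.snoc F p : Fin (n + 1) → ℕ → R) a b := by
    ext a b
    refine Fin.lastCases ?_ (fun a => ?_) a
    · simp
    · simp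
  rw [e, sign_finRotate] at h
  simp only [rowDet, h, Nat.add_sub_cancel]
  push_cast
  rw [← mul_assoc, ← pow_add, Even.neg_one_pow ⟨n, rfl⟩, one_mul]

theorem snoc_shift {S : Type*} (n : ℕ) (y : ℕ → S) :
    (Fin.snoc (fun (a : Fin n) b => y (a + b)) (fun b => y (n + b)) : Fin (n + 1) → ℕ → S) =
      fun (a : Fin (n + 1)) b => y (a + b) := by
  funext a
  refine Fin.lastCases ?_ (fun a => ?_) a <;> simp

theorem rowDet_cons_shift (n : ℕ) (y : ℕ → R) :
    rowDet (vecCons (fun b => y (n + b)) fun (a : Fin n) b => y (a + b)) =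
      (-1) ^ n * hankel (n + 1) y := by
  rw [rowDet_cons_eq_snoc, snoc_shift, rowDet_hankel]

theorem rowDet_pow_cons_shift (n : ℕ) (α : R) (y : ℕ → R) :
    rowDet (vecCons (fun b => α ^ b)
      (vecCons (fun b => y (n + b)) fun (a : Fin n) b => y (a + b))) =
      (-1) ^ n * hankel (n + 1) (mulSub α y) := by
  rw [rowDet_cons_pow, ← rowDet_cons_shift]
  congr 1
  funext a
  refine Fin.cases ?_ (fun a => ?_) a <;> simp [mulSub_shift]

/-- The Plücker relation for an arbitrary functional `p` and the evaluations at `α`, `β`, `γ`, over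
Hankel rows. -/
theorem rowDet_plucker_pow {n : ℕ} (y p : ℕ → R) (α β γ : R) :
    (β - γ) * (rowDet (vecCons (fun b => α ^ b) (vecCons p fun (a : Fin n) b => y (a + b)))
        * hankel n (mulSub β (mulSub γ y)))
      + (γ - α) * (rowDet (vecCons (fun b => β ^ b) (vecCons p fun (a : Fin n) b => y (a + b)))
        * hankel n (mulSub γ (mulSub α y)))
      + (α - β) * (rowDet (vecCons (fun b => γ ^ b) (vecCons p fun (a : Fin n) b => y (a + b)))
        * hankel n (mulSub α (mulSub β y))) = 0 := by
  have h := rowDet_plucker (fun (a : Fin n) b => y (a + b)) p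
    (fun b => α ^ b) (fun b => β ^ b) (fun b => γ ^ b)
  simp only [rowDet_pow_pow, rowDet_swap _ p] at h
  rw [mulSub_comm γ β, mulSub_comm β α] at h
  linear_combination h

/-- The Plücker relation in which `p` is the next Hankel row. -/
theorem sum_hankel_succ_mul_hankel (n : ℕ) (x : ℕ → R) (α β γ : R) :
    (β - γ) * (hankel (n + 1) (mulSub α x) * hankel n (mulSub β (mulSub γ x)))
      + (γ - α) * (hankel (n + 1) (mulSub β x) * hankel n (mulSub γ (mulSub α x)))
      + (α - β) * (hankel (n + 1) (mulSub γ x) * hankel n (mulSub α (mulSub β x))) = 0 := by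
  have h := rowDet_plucker_pow (n := n) x (fun b => x (n + b)) α β γ
  simp only [rowDet_pow_cons_shift] at h
  refine ((isUnit_one.neg.pow n).mul_right_eq_zero (a := (-1 : R) ^ n)).1 ?_
  linear_combination h

/-- The Plücker relation in which `p` is the evaluation at infinity. -/
theorem sum_hankel_mul_hankel (n : ℕ) (v : ℕ → R) (α β γ : R) :
    (β - γ) * (hankel n (mulSub α v) * hankel n (mulSub β (mulSub γ v)))
      + (γ - α) * (hankel n (mulSub β v) * hankel n (mulSub γ (mulSub α v)))
      + (α - β) * (hankel n (mulSub γ v) * hankel n (mulSub α (mulSub β v))) = 0 := by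
  have h := rowDet_plucker_pow (n := n) v (fun b => if b = n + 1 then 1 else 0) α β γ
  simp only [rowDet_swap _ _ (fun b : ℕ => if b = n + 1 then (1 : R) else 0), rowDet_cons_last,
    rowDet_pow_hankel, pow_succ] at h
  refine ((isUnit_one.neg.pow n).mul_right_eq_zero (a := (-1 : R) ^ n)).1 ?_
  linear_combination h

/-- The bilinear identity behind the factorization of the differences of `u` along edges. It is the
Plücker relation for the evaluations `r` at `α` and `s` at infinity, the functionals `v` and
`h ^ k (h - β) v`, and the `k` functionals `h ^ a (h - β) v`, `a < k`. -/
theorem hankel_mul_hankel_sub (k : ℕ) (v : ℕ → R) (α β : R) :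
    hankel (k + 1) v * hankel (k + 1) (mulSub α (mulSub β v))
      - hankel (k + 2) v * hankel k (mulSub α (mulSub β v)) =
      hankel (k + 1) (mulSub α v) * hankel (k + 1) (mulSub β v) := by
  set y := mulSub β v with hy
  let F : Fin k → ℕ → R := fun a b => y (a + b)
  let p : ℕ → R := fun b => y (k + b)
  let r : ℕ → R := fun b => α ^ b
  let s : ℕ → R := fun b => if b = k + 1 then 1 else 0
  have hs : ((-1 : R) ^ k) * (-1) ^ k = 1 := pow_mul_pow_eq_one k (by ring)
  have hpq : rowDet (vecCons p (vecCons v F)) = (-1) ^ (k + 1) * hankel (k + 2) v := by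
    rw [rowDet_cons_eq_snoc, ← rowDet_cons_mulSub β v, ← hy, ← snoc_shift (k) y]
    rw [pow_succ, ← pow_succ]
    congr 2
    exact (Fin.cons_snoc_eq_snoc_cons v F p).symm
  have hrs : rowDet (vecCons r (vecCons s F)) = (-1) ^ k * hankel k (mulSub α y) := by
    rw [rowDet_swap, rowDet_cons_last, rowDet_pow_hankel, pow_succ]
    ring
  have hpr : rowDet (vecCons p (vecCons r F)) = - ((-1) ^ k * hankel (k + 1) (mulSub α y)) := by
    rw [rowDet_swap, rowDet_pow_cons_shift]
  have hqs : rowDet (vecCons v (vecCons s F)) = (-1) ^ k * hankel (k + 1) v := by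
    rw [rowDet_swap, rowDet_cons_last, rowDet_cons_mulSub, pow_succ]
    ring
  have hps : rowDet (vecCons p (vecCons s F)) = hankel (k + 1) y := by
    rw [rowDet_swap, rowDet_cons_last, rowDet_cons_shift, pow_succ]
    linear_combination hs * hankel (k + 1) y
  have hqr : rowDet (vecCons v (vecCons r F)) = - hankel (k + 1) (mulSub α v) := by
    rw [rowDet_swap, rowDet_cons_pow, ← rowDet_cons_mulSub β (mulSub α v), mulSub_comm β α]
    congr 2
    funext a
    refine Fin.cases ?_ (fun a => ?_) a
    · rfl
    · exact mulSub_shift α y a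
  have h := rowDet_plucker F p v r s
  rw [hpq, hrs, hpr, hqs, hps, hqr, pow_succ] at h
  linear_combination h - hs * (hankel (k + 1) v * hankel (k + 1) (mulSub α y)
      - hankel (k + 2) v * hankel k (mulSub α y))

/-! ### Toeplitz determinants as Hankel determinants -/

/-- The sign of the order-reversing permutation of `Fin n`, which turns Toeplitz matrices into
Hankel matrices. -/
def revSign (n : ℕ) : R := ((Equiv.Perm.sign (Fin.revPerm (n := n)) : ℤ) : R)

theorem revSign_mul_self (n : ℕ) : (revSign n * revSign n : R) = 1 := by
  simp only [revSign]
  rw [← Int.cast_mul, ← Units.val_mul, Int.units_mul_self]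
  simp

theorem revSign_succ (n : ℕ) : (revSign (n + 1) : R) = (-1) ^ n * revSign n := by
  have h : ∀ m : ℕ, (revSign m : R) =
      ((1 : Matrix (Fin m) (Fin m) R).submatrix Fin.revPerm id).det := by
    intro m
    rw [det_permute, det_one, mul_one, revSign]
  rw [h, h, det_succ_row_zero, Fin.sum_univ_castSucc, Finset.sum_eq_zero]
  · have : (((1 : Matrix (Fin (n + 1)) (Fin (n + 1)) R).submatrix Fin.revPerm id).submatrix
        Fin.succ (Fin.last n).succAbove) =
        (1 : Matrix (Fin n) (Fin n) R).submatrix Fin.revPerm id := by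
      ext a b
      simp [one_apply, Fin.rev_succ]
    rw [this]
    simp [one_apply]
  · intro b _
    simp [one_apply, Fin.ext_iff, b.2.ne']

/-- The sizes of the two factors of `D₁ D₋₁` differ by `2`; this is the sign by which the bilinear
identity in Toeplitz form differs from the one in Hankel form. -/
theorem revSign_add_two_mul (n : ℕ) : (revSign (n + 2) * revSign n : R) = -1 := by
  rw [revSign_succ, revSign_succ]
  have hs : ((-1 : R) ^ n) * (-1) ^ n = 1 := pow_mul_pow_eq_one n (by ring)
  rw [pow_succ]
  linear_combination -hs * (revSign n * revSign n : R) - revSign_mul_self (R := R) n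

theorem det_toeplitz_eq_hankel (n : ℕ) (f : ℤ → R) (c : ℤ) :
    (of fun a b : Fin n => f (c - ((a : ℕ) : ℤ) + ((b : ℕ) : ℤ))).det =
      revSign n * hankel n fun m => f (m + c + 1 - n) := by
  rw [revSign, hankel, ← det_permute]
  congr 1
  ext a b
  simp only [of_apply, submatrix_apply, Fin.revPerm_apply, id, Fin.val_rev]
  congr 1
  have := a.2
  push_cast [Nat.cast_sub (show (a : ℕ) + 1 ≤ n by omega)]
  ring

end Algebra

/-! ### Moments with integral exponents -/

section Moments

open MeasureTheory Filter Topology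

/-- A point of a level set at which the derivative does not vanish is isolated in that level set. -/
theorem countable_deriv_ne_zero_eq (f : ℝ → ℂ) (c : ℂ) :
    {t | f t = c ∧ deriv f t ≠ 0}.Countable := by
  have hd : DiscreteTopology {t | f t = c ∧ deriv f t ≠ 0} := by
    refine discreteTopology_subtype_iff.2 fun t ht => ?_
    have h := (differentiableAt_of_deriv_ne_zero ht.2).hasDerivAt.eventually_ne (c := c) ht.2
    rw [← disjoint_iff, Filter.disjoint_principal_right]
    filter_upwards [h] with z hz hz'
    exact hz hz'.1
  exact Set.countable_coe_iff.1 (TopologicalSpace.separableSpace_iff_countable.1 inferInstance)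

/-- Even if the contour stays at `c` for a while, `dh` vanishes there. So the points `0` and `αᵢ`,
where powers with a negative exponent take the junk value `0`, do not matter in contour
integrals. -/
theorem Contour.ae_deriv_eq_zero_or_ne (γ : Contour) (c : ℂ) :
    ∀ᵐ t ∂(volume.restrict γ.dom), deriv γ.path t = 0 ∨ γ.path t ≠ c := by
  refine ae_restrict_of_ae ?_
  filter_upwards [(countable_deriv_ne_zero_eq γ.path c).ae_notMem volume] with t ht
  by_contra! h
  exact ht ⟨h.2, h.1⟩

/-- The integrand `ω̂(h) h ^ m ∏ i, (h - αᵢ) ^ μᵢ`, for arbitrary integral exponents `μ`. -/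
noncomputable def powerIntegrand (w : ℂ → ℂ) (α : Fin 3 → ℂ) (μ : Fin 3 → ℤ) (m : ℤ) (h : ℂ) : ℂ :=
  w h * h ^ m * ∏ i, (h - α i) ^ μ i

/-- The integral of `powerIntegrand`. -/
noncomputable def powerMoment (γ : Contour) (w : ℂ → ℂ) (α : Fin 3 → ℂ) (μ : Fin 3 → ℤ)
    (m : ℤ) : ℂ :=
  γ.integral (powerIntegrand w α μ m)

/-- The integral of `powerIntegrand` converges absolutely. -/
def MomentExists (γ : Contour) (w : ℂ → ℂ) (α : Fin 3 → ℂ) (μ : Fin 3 → ℤ) (m : ℤ) : Prop :=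
  γ.Integrable (powerIntegrand w α μ m)

theorem powerIntegrand_add_single (w : ℂ → ℂ) (α : Fin 3 → ℂ) (μ : Fin 3 → ℤ) (m : ℤ) (i : Fin 3)
    {h : ℂ} (h0 : h ≠ 0) (hi : h ≠ α i) :
    powerIntegrand w α (μ + Pi.single i 1) m h =
      powerIntegrand w α μ (m + 1) h - α i * powerIntegrand w α μ m h := by
  have hp : ∏ j, (h - α j) ^ (μ + Pi.single i 1 : Fin 3 → ℤ) j =
      (h - α i) * ∏ j, (h - α j) ^ μ j := by
    rw [← Finset.mul_prod_erase _ _ (Finset.mem_univ i),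
      ← Finset.mul_prod_erase _ (fun j => (h - α j) ^ μ j) (Finset.mem_univ i), ← mul_assoc]
    congr 1
    · rw [Pi.add_apply, Pi.single_eq_same, zpow_add_one₀ (sub_ne_zero.2 hi), mul_comm]
    · refine Finset.prod_congr rfl fun j hj => ?_
      rw [Pi.add_apply, Pi.single_eq_of_ne (Finset.ne_of_mem_erase hj), add_zero]
  simp only [powerIntegrand]
  rw [hp, zpow_add_one₀ h0]
  ring

variable {γ : Contour} {w : ℂ → ℂ} {α : Fin 3 → ℂ}

theorem ae_powerIntegrand_add_single (γ : Contour) (w : ℂ → ℂ) (α : Fin 3 → ℂ) (μ : Fin 3 → ℤ)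
    (m : ℤ) (i : Fin 3) :
    ∀ᵐ t ∂(volume.restrict γ.dom),
      powerIntegrand w α (μ + Pi.single i 1) m (γ.path t) * deriv γ.path t =
        powerIntegrand w α μ (m + 1) (γ.path t) * deriv γ.path t
          - α i * (powerIntegrand w α μ m (γ.path t) * deriv γ.path t) := by
  filter_upwards [γ.ae_deriv_eq_zero_or_ne 0, γ.ae_deriv_eq_zero_or_ne (α i)] with t h0 hi
  rcases h0 with h | h0
  · simp [h]
  rcases hi with h | hi
  · simp [h]
  rw [powerIntegrand_add_single w α μ m i h0 hi]
  ring

theorem MomentExists.add_single {μ : Fin 3 → ℤ} {m : ℤ} (i : Fin 3)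
    (h₁ : MomentExists γ w α μ (m + 1)) (h₀ : MomentExists γ w α μ m) :
    MomentExists γ w α (μ + Pi.single i 1) m :=
  ((Integrable.sub h₁ (Integrable.const_mul h₀ (α i))).congr
    ((ae_powerIntegrand_add_single γ w α μ m i).mono fun _ h => h.symm) :)

theorem powerMoment_add_single {μ : Fin 3 → ℤ} {m : ℤ} (i : Fin 3)
    (h₁ : MomentExists γ w α μ (m + 1)) (h₀ : MomentExists γ w α μ m) :
    powerMoment γ w α (μ + Pi.single i 1) m =
      powerMoment γ w α μ (m + 1) - α i * powerMoment γ w α μ m := by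
  simp only [powerMoment, Contour.integral]
  rw [integral_congr_ae (ae_powerIntegrand_add_single γ w α μ m i),
    integral_sub h₁ (Integrable.const_mul h₀ (α i)), integral_const_mul]

theorem MomentExists.succ {μ : Fin 3 → ℤ} {m : ℤ} (i : Fin 3)
    (h₁ : MomentExists γ w α (μ + Pi.single i 1) m) (h₀ : MomentExists γ w α μ m) :
    MomentExists γ w α μ (m + 1) := by
  refine ((Integrable.add h₁ (Integrable.const_mul h₀ (α i))).congr ?_ :)
  filter_upwards [ae_powerIntegrand_add_single γ w α μ m i] with t h
  simp only [Pi.add_apply]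
  rw [h]
  ring

/-- `(h - αᵢ) X - (h - αⱼ) X = (αⱼ - αᵢ) X`, so `X` is integrable if both terms are. -/
theorem MomentExists.of_add_single {μ : Fin 3 → ℤ} {m : ℤ} {i j : Fin 3} (hij : α i ≠ α j)
    (hi : MomentExists γ w α (μ + Pi.single i 1) m)
    (hj : MomentExists γ w α (μ + Pi.single j 1) m) : MomentExists γ w α μ m := by
  refine ((Integrable.const_mul (Integrable.sub hi hj) (α j - α i)⁻¹).congr ?_ :)
  filter_upwards [ae_powerIntegrand_add_single γ w α μ m i,
    ae_powerIntegrand_add_single γ w α μ m j] with t hi hj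
  simp only [Pi.sub_apply]
  have : α j - α i ≠ 0 := sub_ne_zero.2 hij.symm
  rw [hi, hj]
  field_simp
  ring

end Moments

/-! ### Exponents of neighbouring vertices -/

/-- The exponents `nᵢ - 𝒩(n)` of the weight at the vertex represented by `n`. -/
def exponents (n : Fin 3 → ℤ) (i : Fin 3) : ℤ := n i - shift n

theorem shift_of_inLattice {ε : ℤˣ} {n : Fin 3 → ℤ} (h : InLattice ε n) :
    3 * shift n = (∑ i, n i) + if ε = 1 then 0 else 2 := by
  unfold InLattice at h
  unfold shift
  split_ifs at h ⊢ <;> unfold Int.ModEq at h <;> omega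

theorem sum_add_single (n : Fin 3 → ℤ) (i : Fin 3) (c : ℤ) :
    ∑ j, (n + Pi.single i c : Fin 3 → ℤ) j = (∑ j, n j) + c := by
  simp [Finset.sum_add_distrib]

theorem InLattice.add_single {n : Fin 3 → ℤ} (h : InLattice 1 n) (i : Fin 3) :
    InLattice (-1) (n + Pi.single i 1) := by
  unfold InLattice at *
  rw [sum_add_single, if_neg (by decide)]
  rw [if_pos rfl] at h
  exact h.add_right 1

theorem InLattice.sub_single {n : Fin 3 → ℤ} (h : InLattice (-1) n) (i : Fin 3) :
    InLattice 1 (n - Pi.single i 1) := by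
  unfold InLattice at *
  rw [sub_eq_add_neg, ← Pi.single_neg, sum_add_single, if_pos rfl]
  rw [if_neg (by decide)] at h
  exact h.add_right (-1)

/-- The weight at `n + eᵢ` is the weight at `n` divided by `(h - αⱼ) (h - αₖ)`, where `i, j, k` are
distinct. It is written as `h - αᵢ` times a weight which does not depend on `i`. -/
theorem exponents_add_single {n : Fin 3 → ℤ} (h : InLattice 1 n) (i : Fin 3) :
    exponents (n + Pi.single i 1) = exponents n - 1 + Pi.single i 1 := by
  have h₁ := shift_of_inLattice h
  have h₂ := shift_of_inLattice (h.add_single i)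
  rw [sum_add_single, if_neg (by decide)] at h₂
  rw [if_pos rfl] at h₁
  funext j
  simp only [exponents, Pi.add_apply, Pi.sub_apply, Pi.one_apply]
  omega

theorem add_single_three (μ : Fin 3 → ℤ) (i : Fin 3) :
    μ - 1 + Pi.single i 1 + Pi.single (i - 1) 1 + Pi.single (i + 1) 1 = μ := by
  funext j
  simp only [Pi.add_apply, Pi.sub_apply, Pi.one_apply, Pi.single_apply]
  fin_cases i <;> fin_cases j <;> simp [show (-1 : Fin 3) = 2 from rfl]

/-- The weight at `n - eᵢ` is the weight at `n` times `(h - αⱼ) (h - αₖ)`, where `i, j, k` are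
distinct. -/
theorem exponents_sub_single {n : Fin 3 → ℤ} (h : InLattice (-1) n) (i : Fin 3) :
    exponents (n - Pi.single i 1) = exponents n + Pi.single (i - 1) 1 + Pi.single (i + 1) 1 := by
  have h₁ := exponents_add_single (h.sub_single i) i
  rw [sub_add_cancel] at h₁
  rw [h₁, add_single_three]

/-! ### Sequences of moments -/

/-- The moments with exponents `μ`, numbered so that the Hankel determinants of this one sequence
are, up to sign, the determinants `D_k` for all `k`: the term of index `m` is the moment of
`h ^ (m + 1 - ℓ)`. -/
noncomputable def momentSeq (γ : Contour) (w : ℂ → ℂ) (α : Fin 3 → ℂ) (ℓ : ℕ) (μ : Fin 3 → ℤ)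
    (m : ℕ) : ℂ :=
  powerMoment γ w α μ (m + 1 - ℓ)

variable {γ : Contour} {w : ℂ → ℂ} {α : Fin 3 → ℂ} {ℓ : ℕ}

theorem toeplitzD_eq_hankel (n : Fin 3 → ℤ) {k : ℤ} {N : ℕ} (h : (ℓ : ℤ) + k = N) :
    toeplitzD γ w α ℓ k n = revSign N * hankel N (momentSeq γ w α ℓ (exponents n)) := by
  have hN : ((ℓ : ℤ) + k).toNat = N := by omega
  unfold toeplitzD
  rw [hN]
  refine (det_toeplitz_eq_hankel N (fun m => moment γ w α m n) k).trans ?_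
  congr 2
  funext m
  rw [show (m : ℤ) + k + 1 - N = m + 1 - ℓ by omega]
  rfl

/-- The terms of `momentSeq` of index at most `M` are absolutely convergent integrals. -/
def MomentsExistUpTo (γ : Contour) (w : ℂ → ℂ) (α : Fin 3 → ℂ) (ℓ : ℕ) (μ : Fin 3 → ℤ)
    (M : ℕ) : Prop :=
  ∀ m : ℕ, m ≤ M → MomentExists γ w α μ (m + 1 - ℓ)

theorem MomentsExist.upTo (hw : MomentsExist γ w α ℓ) {n : Fin 3 → ℤ} (hn : InLattice (-1) n) :
    MomentsExistUpTo γ w α ℓ (exponents n) (2 * ℓ) := by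
  intro m hm
  have key : ∀ a b : ℕ, a ≤ ℓ → b ≤ ℓ →
      MomentExists γ w α (exponents n) (1 - (a : ℤ) + (b : ℤ)) := fun a b ha hb =>
    hw (-1) n hn 1 (Or.inr (by simp)) ⟨a, by omega⟩ ⟨b, by omega⟩
  rcases le_total m ℓ with h | h
  · have := key (ℓ - m) 0 (by omega) (by omega)
    rwa [show (1 : ℤ) - ((ℓ - m : ℕ) : ℤ) + ((0 : ℕ) : ℤ) = m + 1 - ℓ by omega] at this
  · have := key 0 (m - ℓ) (by omega) (by omega)
    rwa [show (1 : ℤ) - ((0 : ℕ) : ℤ) + ((m - ℓ : ℕ) : ℤ) = m + 1 - ℓ by omega] at this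

namespace MomentsExistUpTo

variable {μ : Fin 3 → ℤ} {M : ℕ}

theorem add_single (h : MomentsExistUpTo γ w α ℓ μ (M + 1)) (i : Fin 3) :
    MomentsExistUpTo γ w α ℓ (μ + Pi.single i 1) M := by
  intro m hm
  have h₁ := h (m + 1) (by omega)
  rw [show ((m + 1 : ℕ) : ℤ) + 1 - ℓ = m + 1 - ℓ + 1 by push_cast; ring] at h₁
  exact h₁.add_single i (h m (by omega))

theorem momentSeq_add_single (h : MomentsExistUpTo γ w α ℓ μ (M + 1)) (i : Fin 3) {m : ℕ}
    (hm : m ≤ M) :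
    momentSeq γ w α ℓ (μ + Pi.single i 1) m = mulSub (α i) (momentSeq γ w α ℓ μ) m := by
  have h₁ := h (m + 1) (by omega)
  rw [show ((m + 1 : ℕ) : ℤ) + 1 - ℓ = m + 1 - ℓ + 1 by push_cast; ring] at h₁
  simp only [mulSub, momentSeq]
  rw [show ((m + 1 : ℕ) : ℤ) + 1 - ℓ = m + 1 - ℓ + 1 by push_cast; ring]
  exact powerMoment_add_single i h₁ (h m (by omega))

theorem momentSeq_add_single_add_single (h : MomentsExistUpTo γ w α ℓ μ (M + 2)) (i j : Fin 3)
    {m : ℕ} (hm : m ≤ M) :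
    momentSeq γ w α ℓ (μ + Pi.single i 1 + Pi.single j 1) m =
      mulSub (α j) (mulSub (α i) (momentSeq γ w α ℓ μ)) m := by
  rw [(h.add_single i).momentSeq_add_single j hm, mulSub, h.momentSeq_add_single i (by omega),
    h.momentSeq_add_single i (by omega)]
  rfl

theorem momentSeq_add_single_three (h : MomentsExistUpTo γ w α ℓ μ (M + 3)) (i j k : Fin 3)
    {m : ℕ} (hm : m ≤ M) :
    momentSeq γ w α ℓ (μ + Pi.single i 1 + Pi.single j 1 + Pi.single k 1) m =
      mulSub (α k) (mulSub (α j) (mulSub (α i) (momentSeq γ w α ℓ μ))) m := by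
  rw [((h.add_single i).add_single j).momentSeq_add_single k hm, mulSub,
    h.momentSeq_add_single_add_single i j (by omega),
    h.momentSeq_add_single_add_single i j (by omega)]
  rfl

theorem of_add_single {i j : Fin 3} (hij : α i ≠ α j)
    (hi : MomentsExistUpTo γ w α ℓ (μ + Pi.single i 1) M)
    (hj : MomentsExistUpTo γ w α ℓ (μ + Pi.single j 1) M) :
    MomentsExistUpTo γ w α ℓ μ (M + 1) := by
  have hlow : MomentsExistUpTo γ w α ℓ μ M := fun m hm =>
    MomentExists.of_add_single hij (hi m hm) (hj m hm)
  intro m hm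
  rcases Nat.lt_or_ge M m with h | h
  -- The top moment of `X` comes from `h X = (h - αᵢ) X + αᵢ X`.
  · obtain rfl : m = M + 1 := by omega
    have := MomentExists.succ i (hi M le_rfl) (hlow M le_rfl)
    rwa [show ((M + 1 : ℕ) : ℤ) + 1 - ℓ = M + 1 - ℓ + 1 by push_cast; ring]
  · exact hlow m h

end MomentsExistUpTo

/-! ### Factorization along the edges -/

/-- At a vertex of `Λ⁻`, with weight `V`: the differences of `u` along the three edges factor
through numbers `A i`, attached to the three adjacent hexagons, which are Hankel determinants of
the weights `(h - αᵢ) V`. -/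
theorem exists_edge_factors_minus (hℓ : 1 ≤ ℓ) (hw : MomentsExist γ w α ℓ) {n : Fin 3 → ℤ}
    (hn : InLattice (-1) n) :
    ∃ A : Fin 3 → ℂ,
      (∀ i, toeplitzD γ w α ℓ 0 n * toeplitzD γ w α ℓ 0 (n - Pi.single i 1)
        + toeplitzD γ w α ℓ 1 n * toeplitzD γ w α ℓ (-1) (n - Pi.single i 1) =
          A (i + 1) * A (i - 1)) ∧
      ∑ i, (α (i + 1) - α (i - 1)) * (toeplitzD γ w α ℓ 0 (n - Pi.single i 1) * A i) = 0 := by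
  obtain ⟨k, rfl⟩ : ∃ k, ℓ = k + 1 := ⟨ℓ - 1, by omega⟩
  have hv := hw.upTo hn
  rw [show 2 * (k + 1) = 2 * k + 2 by ring] at hv
  set v := momentSeq γ w α (k + 1) (exponents n) with hvdef
  have hW : ∀ (i : Fin 3) (N : ℕ), N ≤ k + 1 →
      hankel N (momentSeq γ w α (k + 1) (exponents (n - Pi.single i 1))) =
        hankel N (mulSub (α (i + 1)) (mulSub (α (i - 1)) v)) := fun i N hN =>
    hankel_congr fun m hm => by
      rw [exponents_sub_single hn i]
      exact hv.momentSeq_add_single_add_single _ _ (by omega)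
  have hD0 : ∀ n, toeplitzD γ w α (k + 1) 0 n = _ := fun n =>
    toeplitzD_eq_hankel n (N := k + 1) (by simp)
  have hD1 : toeplitzD γ w α (k + 1) 1 n = _ :=
    toeplitzD_eq_hankel n (N := k + 2) (by push_cast; ring)
  have hDm : ∀ n, toeplitzD γ w α (k + 1) (-1) n = _ := fun n =>
    toeplitzD_eq_hankel n (N := k) (by push_cast; ring)
  refine ⟨fun i => hankel (k + 1) (mulSub (α i) v), fun i => ?_, ?_⟩
  · rw [hD0, hD0, hD1, hDm, hW i _ le_rfl, hW i _ (by omega), ← hankel_mul_hankel_sub, ← hvdef]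
    linear_combination
      (hankel (k + 1) v * hankel (k + 1) (mulSub (α (i + 1)) (mulSub (α (i - 1)) v))) *
        revSign_mul_self (R := ℂ) (k + 1) +
      (hankel (k + 2) v * hankel k (mulSub (α (i + 1)) (mulSub (α (i - 1)) v))) *
        revSign_add_two_mul (R := ℂ) k
  · have h := sum_hankel_mul_hankel (k + 1) v (α 0) (α 1) (α 2)
    simp only [hD0, hW _ _ le_rfl, Fin.sum_univ_three]
    simp only [show (0 : Fin 3) + 1 = 1 from rfl, show (0 : Fin 3) - 1 = 2 from rfl,
      show (1 : Fin 3) + 1 = 2 from rfl, show (1 : Fin 3) - 1 = 0 from rfl,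
      show (2 : Fin 3) + 1 = 0 from rfl, show (2 : Fin 3) - 1 = 1 from rfl]
    linear_combination revSign (k + 1) * h

/-- At a vertex of `Λ⁺`, with weight `W`: here all weights of the star are multiples of
`X = W / ∏ (h - αᵢ)`, with `A i` belonging to `W / (h - αᵢ)`. The moments of `X` exist because some
`αᵢ` and `αⱼ` differ. -/
theorem exists_edge_factors_plus (hℓ : 1 ≤ ℓ) (hw : MomentsExist γ w α ℓ) {n : Fin 3 → ℤ}
    (hn : InLattice 1 n) {i₀ j₀ : Fin 3} (hα : α i₀ ≠ α j₀) :
    ∃ A : Fin 3 → ℂ,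
      (∀ i, toeplitzD γ w α ℓ (-1) n * toeplitzD γ w α ℓ 1 (n + Pi.single i 1)
        + toeplitzD γ w α ℓ 0 (n + Pi.single i 1) * toeplitzD γ w α ℓ 0 n =
          A (i + 1) * A (i - 1)) ∧
      ∑ i, (α (i + 1) - α (i - 1)) * (toeplitzD γ w α ℓ 1 (n + Pi.single i 1) * A i) = 0 := by
  obtain ⟨k, rfl⟩ : ∃ k, ℓ = k + 1 := ⟨ℓ - 1, by omega⟩
  have hV : ∀ i, MomentsExistUpTo γ w α (k + 1) (exponents n - 1 + Pi.single i 1) (2 * k + 2) := by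
    intro i
    rw [← exponents_add_single hn i]
    exact hw.upTo (hn.add_single i)
  have hx : MomentsExistUpTo γ w α (k + 1) (exponents n - 1) (2 * k + 2 + 1) :=
    .of_add_single hα (hV _) (hV _)
  set x := momentSeq γ w α (k + 1) (exponents n - 1) with hxdef
  have hV' : ∀ (i : Fin 3) (N : ℕ), N ≤ k + 2 →
      hankel N (momentSeq γ w α (k + 1) (exponents (n + Pi.single i 1))) =
        hankel N (mulSub (α i) x) := fun i N hN =>
    hankel_congr fun m hm => by
      rw [exponents_add_single hn i]
      exact hx.momentSeq_add_single _ (by omega)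
  have hW : ∀ (i : Fin 3) (N : ℕ), N ≤ k + 1 →
      hankel N (momentSeq γ w α (k + 1) (exponents n)) =
        hankel N (mulSub (α (i + 1)) (mulSub (α (i - 1)) (mulSub (α i) x))) := fun i N hN =>
    hankel_congr fun m hm => by
      rw [← add_single_three (exponents n) i]
      exact MomentsExistUpTo.momentSeq_add_single_three (M := 2 * k) hx _ _ _ (by omega)
  have hD0 : ∀ n, toeplitzD γ w α (k + 1) 0 n = _ := fun n =>
    toeplitzD_eq_hankel n (N := k + 1) (by simp)
  have hD1 : ∀ n, toeplitzD γ w α (k + 1) 1 n = _ := fun n =>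
    toeplitzD_eq_hankel n (N := k + 2) (by push_cast; ring)
  have hDm : toeplitzD γ w α (k + 1) (-1) n = _ :=
    toeplitzD_eq_hankel n (N := k) (by push_cast; ring)
  refine ⟨fun i => hankel (k + 1) (mulSub (α (i + 1)) (mulSub (α (i - 1)) x)), fun i => ?_, ?_⟩
  · have h := hankel_mul_hankel_sub k (mulSub (α i) x) (α (i + 1)) (α (i - 1))
    have e₁ : i + 1 + 1 = i - 1 := by fin_cases i <;> rfl
    have e₂ : i + 1 - 1 = i := by fin_cases i <;> rfl
    have e₃ : i - 1 + 1 = i := by fin_cases i <;> rfl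
    have e₄ : i - 1 - 1 = i + 1 := by fin_cases i <;> rfl
    rw [hD0, hD0, hD1, hDm, hV' i _ le_rfl, hV' i _ (by omega), hW i _ le_rfl, hW i _ (by omega)]
    beta_reduce
    rw [e₁, e₂, e₃, e₄, mulSub_comm (α i) (α (i + 1))]
    linear_combination h +
      (hankel (k + 1) (mulSub (α i) x) *
        hankel (k + 1) (mulSub (α (i + 1)) (mulSub (α (i - 1)) (mulSub (α i) x)))) *
        revSign_mul_self (R := ℂ) (k + 1) +
      (hankel (k + 2) (mulSub (α i) x) *
        hankel k (mulSub (α (i + 1)) (mulSub (α (i - 1)) (mulSub (α i) x)))) *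
        revSign_add_two_mul (R := ℂ) k
  · have h := sum_hankel_succ_mul_hankel (k + 1) x (α 0) (α 1) (α 2)
    simp only [hD1, hV' _ _ le_rfl, Fin.sum_univ_three]
    simp only [show (0 : Fin 3) + 1 = 1 from rfl, show (0 : Fin 3) - 1 = 2 from rfl,
      show (1 : Fin 3) + 1 = 2 from rfl, show (1 : Fin 3) - 1 = 0 from rfl,
      show (2 : Fin 3) + 1 = 0 from rfl, show (2 : Fin 3) - 1 = 1 from rfl]
    linear_combination revSign (k + 2) * h

/-- If `dᵢ = Aⱼ Aₖ / (c Tᵢ)` for distinct `i, j, k`, then `∑ Γᵢ / dᵢ` is a multiple of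
`∑ Γᵢ Tᵢ Aᵢ`. -/
theorem sum_div_eq_zero {Γ A T d : Fin 3 → ℂ} {c : ℂ} (hc : c ≠ 0) (hT : ∀ i, T i ≠ 0)
    (hd : ∀ i, d i ≠ 0) (hA : ∀ i, d i * (c * T i) = A (i + 1) * A (i - 1))
    (hsum : ∑ i, Γ i * (T i * A i) = 0) : ∑ i, Γ i / d i = 0 := by
  have hA0 : ∀ i, A i ≠ 0 := fun i h => by
    have h' := hA (i - 1)
    rw [sub_add_cancel, h, zero_mul] at h'
    exact mul_ne_zero (hd _) (mul_ne_zero hc (hT _)) h'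
  have key : ∀ i, Γ i / d i = c / (A 0 * A 1 * A 2) * (Γ i * (T i * A i)) := by
    intro i
    have hp : A 0 * A 1 * A 2 = A i * (d i * (c * T i)) := by
      rw [hA]
      fin_cases i
      · change _ = A 0 * (A 1 * A 2); ring
      · change _ = A 1 * (A 2 * A 0); ring
      · change _ = A 2 * (A 0 * A 1); ring
    have := hA0 i
    have := hT i
    have := hd i
    rw [hp]
    field_simp
  rw [Finset.sum_congr rfl fun i _ => key i, ← Finset.mul_sum, hsum, mul_zero]

/-! ### Independence of the representing triple -/

section Node

variable {E : Type*} [AddCommGroup E]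

theorem node_add_single (e : Fin 3 → E) (n : Fin 3 → ℤ) (i : Fin 3) :
    node e (n + Pi.single i 1) = node e n + e i := by
  simp [node, add_smul, Finset.sum_add_distrib, Pi.single_apply, ite_smul]

theorem node_sub_single (e : Fin 3 → E) (n : Fin 3 → ℤ) (i : Fin 3) :
    node e (n - Pi.single i 1) = node e n - e i := by
  rw [eq_sub_iff_add_eq, ← node_add_single, sub_add_cancel]

theorem eq_add_const_of_node_eq [Module ℝ E] {e : Fin 3 → E} (he : ∑ i, e i = 0)
    (hind : LinearIndependent ℝ ![e 0, e 1]) {n n' : Fin 3 → ℤ} (h : node e n = node e n') :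
    ∃ c : ℤ, n' = n + fun _ => c := by
  have he2 : e 2 = -(e 0 + e 1) := by
    rw [Fin.sum_univ_three] at he
    exact (neg_eq_of_add_eq_zero_right he).symm
  simp only [node, Fin.sum_univ_three, he2] at h
  have h' : ((n 0 - n 2 - n' 0 + n' 2 : ℤ) : ℝ) • e 0 + ((n 1 - n 2 - n' 1 + n' 2 : ℤ) : ℝ) • e 1
      = 0 := by
    rw [Int.cast_smul_eq_zsmul, Int.cast_smul_eq_zsmul]
    rw [← sub_eq_zero] at h
    rw [← h]
    module
  obtain ⟨h0, h1⟩ := LinearIndependent.pair_iff.1 hind _ _ h'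
  have h0 : n 0 - n 2 - n' 0 + n' 2 = 0 := by exact_mod_cast h0
  have h1 : n 1 - n 2 - n' 1 + n' 2 = 0 := by exact_mod_cast h1
  refine ⟨n' 2 - n 2, funext fun j => ?_⟩
  fin_cases j <;> simp <;> omega

end Node

theorem shift_add_const (n : Fin 3 → ℤ) (c : ℤ) : shift (n + fun _ => c) = shift n + c := by
  simp only [shift, Fin.sum_univ_three, Pi.add_apply]
  omega

theorem exponents_add_const (n : Fin 3 → ℤ) (c : ℤ) :
    exponents (n + fun _ => c) = exponents n := by
  funext i
  simp only [exponents, shift_add_const, Pi.add_apply]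
  ring

theorem toeplitzD_congr {n n' : Fin 3 → ℤ} (h : exponents n = exponents n') (k : ℤ) :
    toeplitzD γ w α ℓ k n = toeplitzD γ w α ℓ k n' := by
  have : ∀ m, moment γ w α m n = moment γ w α m n' := fun m =>
    congrArg (fun μ => powerMoment γ w α μ m) h
  simp only [toeplitzD, this]

theorem sign_eq_of_inLattice {n : Fin 3 → ℤ} {c : ℤ} {ε ε' : ℤˣ} (h : InLattice ε n)
    (h' : InLattice ε' (n + fun _ => c)) : ε = ε' := by
  have h₁ := shift_of_inLattice h
  have h₂ := shift_of_inLattice h'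
  rw [shift_add_const] at h₂
  simp only [Fin.sum_univ_three, Pi.add_apply] at h₁ h₂
  rcases Int.units_eq_one_or ε with rfl | rfl <;> rcases Int.units_eq_one_or ε' with rfl | rfl
  · rfl
  · simp at h₁ h₂; omega
  · simp at h₁ h₂; omega
  · rfl

theorem exists_function_of_values {E : Type*} [AddCommGroup E] [Module ℝ E]
    (e : Fin 3 → E) (he : ∑ i, e i = 0) (hind : LinearIndependent ℝ ![e 0, e 1])
    (ℓ : ℕ) (α : Fin 3 → ℂ) (γ : Contour) (w : ℂ → ℂ) :
    ∃ u : E → ℂ, ∀ (ε : ℤˣ) (n : Fin 3 → ℤ), InLattice ε n →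
      u (node e n) = ((ε : ℤ) : ℂ) *
        (toeplitzD γ w α ℓ (-(ε : ℤ)) n / toeplitzD γ w α ℓ 0 n) ^ (ε : ℤ) := by
  classical
  let f : ℤˣ → (Fin 3 → ℤ) → ℂ := fun ε n => ((ε : ℤ) : ℂ) *
    (toeplitzD γ w α ℓ (-(ε : ℤ)) n / toeplitzD γ w α ℓ 0 n) ^ (ε : ℤ)
  let P : E → ℤˣ × (Fin 3 → ℤ) → Prop := fun x q => InLattice q.1 q.2 ∧ node e q.2 = x
  refine ⟨fun x => if h : ∃ q, P x q then f h.choose.1 h.choose.2 else 0, fun ε n hn => ?_⟩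
  have h : ∃ q, P (node e n) q := ⟨(ε, n), hn, rfl⟩
  beta_reduce
  rw [dif_pos h]
  obtain ⟨hq, hq'⟩ := h.choose_spec
  obtain ⟨c, hc⟩ := eq_add_const_of_node_eq he hind hq'.symm
  rw [hc] at hq
  have hε : h.choose.1 = ε := (sign_eq_of_inLattice hn hq).symm
  have hD : ∀ k, toeplitzD γ w α ℓ k h.choose.2 = toeplitzD γ w α ℓ k n :=
    toeplitzD_congr (by rw [hc, exponents_add_const])
  simp only [f, hε, hD]

end Honeycomb

theorem mainTheorem3 {E : Type*} [AddCommGroup E] [Module ℝ E]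
    (e : Fin 3 → E) (he : ∑ i, e i = 0) (hind : LinearIndependent ℝ ![e 0, e 1])
    (ℓ : ℕ) (hℓ : 1 ≤ ℓ) (α : Fin 3 → ℂ) (γ : Honeycomb.Contour) (w : ℂ → ℂ)
    (hw : Honeycomb.MomentsExist γ w α ℓ)
    (Γ : Fin 3 → ℂ) (hΓ : ∀ i, Γ i = α (i + 1) - α (i - 1)) :
    ∑ i, Γ i = 0 ∧
    ∃ u : E → ℂ,
      (∀ (ε : ℤˣ) (n : Fin 3 → ℤ), Honeycomb.InLattice ε n →
        u (Honeycomb.node e n) = ((ε : ℤ) : ℂ) *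
          (Honeycomb.toeplitzD γ w α ℓ (-(ε : ℤ)) n /
            Honeycomb.toeplitzD γ w α ℓ 0 n) ^ (ε : ℤ)) ∧
      (∀ n : Fin 3 → ℤ, Honeycomb.InLattice 1 n →
        Honeycomb.toeplitzD γ w α ℓ 0 n ≠ 0 →
        (∀ i, Honeycomb.toeplitzD γ w α ℓ 1 (n + Pi.single i 1) ≠ 0) →
        (∀ i, u (Honeycomb.node e n) ≠ u (Honeycomb.node e n + e i)) →
        ∑ i, Γ i / (u (Honeycomb.node e n) - u (Honeycomb.node e n + e i)) = 0) ∧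
      (∀ n : Fin 3 → ℤ, Honeycomb.InLattice (-1) n →
        Honeycomb.toeplitzD γ w α ℓ 1 n ≠ 0 →
        (∀ i, Honeycomb.toeplitzD γ w α ℓ 0 (n - Pi.single i 1) ≠ 0) →
        (∀ i, u (Honeycomb.node e n) ≠ u (Honeycomb.node e n - e i)) →
        ∑ i, Γ i / (u (Honeycomb.node e n) - u (Honeycomb.node e n - e i)) = 0) := by
  obtain ⟨u, hu⟩ := Honeycomb.exists_function_of_values e he hind ℓ α γ w
  have hu_plus : ∀ n, Honeycomb.InLattice 1 n → u (Honeycomb.node e n) =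
      Honeycomb.toeplitzD γ w α ℓ (-1) n / Honeycomb.toeplitzD γ w α ℓ 0 n := fun n hn => by
    simp [hu 1 n hn]
  have hu_minus : ∀ n, Honeycomb.InLattice (-1) n → u (Honeycomb.node e n) =
      -(Honeycomb.toeplitzD γ w α ℓ 0 n / Honeycomb.toeplitzD γ w α ℓ 1 n) := fun n hn => by
    simp [hu (-1) n hn]
  refine ⟨?_, u, hu, fun n hn h0 h1 hne => ?_, fun n hn h1 h0 hne => ?_⟩
  · simp only [hΓ, Finset.sum_sub_distrib]
    exact sub_eq_zero.2 ((Equiv.sum_comp (Equiv.addRight (1 : Fin 3)) α).trans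
      (Equiv.sum_comp (Equiv.subRight (1 : Fin 3)) α).symm)
  -- If all `αᵢ` coincide, every `Γᵢ` vanishes.
  · by_cases hα : ∃ i j, α i ≠ α j
    · obtain ⟨i₀, j₀, hα⟩ := hα
      obtain ⟨A, hA, hsum⟩ := Honeycomb.exists_edge_factors_plus hℓ hw hn hα
      refine Honeycomb.sum_div_eq_zero h0 h1 (fun i => sub_ne_zero.2 (hne i)) (fun i => ?_)
        (by simpa only [hΓ] using hsum)
      rw [← hA, ← Honeycomb.node_add_single, hu_plus n hn, hu_minus _ (hn.add_single i)]
      have := h1 i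
      field_simp
      ring
    · push Not at hα
      refine Finset.sum_eq_zero fun i _ => ?_
      rw [hΓ, hα (i + 1) (i - 1), sub_self, zero_div]
  · obtain ⟨A, hA, hsum⟩ := Honeycomb.exists_edge_factors_minus hℓ hw hn
    refine Honeycomb.sum_div_eq_zero (neg_ne_zero.2 h1) h0 (fun i => sub_ne_zero.2 (hne i))
      (fun i => ?_) (by simpa only [hΓ] using hsum)
    rw [← hA, ← Honeycomb.node_sub_single, hu_minus n hn, hu_plus _ (hn.sub_single i)]
    have := h0 i
    field_simp
    ring
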